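/- A permutation array of length $n$ and distance $d$ is a set of permutations of $\{0,1,\dots,n-1\}$, any two distinct members of which, regarded as $n$-tuples, differ in at least $d$ positions; $P(n,d)$ denotes the maximum size of such a set. Put $$V(n,r)=\sum_{i=0}^{r}\binom{n}{i}D_i,\qquad V_2(n,r)=\sum_{i=0}^{r}\binom{n}{i},$$ where $D_i$ is the number of derangements of $i$ points ($D_0=1$); these are the sizes of the Hamming balls of radius $r$ in the symmetric group $S_n$ and in $\{0,1\}^n$, respectively. **Theorem.** Let $\alpha$ be a real constant with $0<\alpha<1/2$. Then there is a constant $c>0$, depending only on $\alpha$, such that for all positive integers $n$ and $d$ with $d=\alpha n$, where $\alpha n$ is rounded down or up to an integer if it is not one (that is, for all positive integers $n,d$ with $|d-\alpha n|<1$), $$P(n,d)\ \ge\ c\cdot\frac{n!}{V(n,d-1)}\,\log_2 V_2(n,d-1).$$ -/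

import Mathlib

/-- A permutation array of length `n` and distance `d`: a set of permutations of
`{0, …, n-1}`, written as `n`-tuples, whose distinct members have Hamming distance
at least `d`. -/
def IsPermArray (n d : ℕ) (C : Finset (Equiv.Perm (Fin n))) : Prop :=
  ∀ x ∈ C, ∀ y ∈ C, x ≠ y → d ≤ hammingDist (x : Fin n → Fin n) (y : Fin n → Fin n)

open Classical in
/-- `P(n, d)`: the maximum size of a permutation array of length `n` and distance `d`. -/
noncomputable def maxPermArray (n d : ℕ) : ℕ :=
  ((Finset.univ : Finset (Finset (Equiv.Perm (Fin n)))).filter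
    (fun C => IsPermArray n d C)).sup Finset.card

/-- `V(n, r)`: the volume of the Hamming ball of radius `r` in `S_n`, that is
`∑_{i=0}^{r} (n choose i) D_i` with `D_i` the number of derangements of `i` points. -/
def permBallVol (n r : ℕ) : ℕ :=
  ∑ i ∈ Finset.range (r + 1), n.choose i * numDerangements i

/-- `V₂(n, r)`: the volume of the Hamming ball of radius `r` in `{0,1}^n`, that is
`∑_{i=0}^{r} (n choose i)`. -/
def binBallVol (n r : ℕ) : ℕ :=
  ∑ i ∈ Finset.range (r + 1), n.choose i

/-! Put `r = d - 1` and join distinct permutations at distance at most `r`; permutation arrays are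
the independent sets of this graph. Its degrees are at most `D = V(n, r)`, so a greedy choice yields
about `n! / D`. The logarithmic gain comes from sparse neighbourhoods.

Draw an independent set `I` from the hard-core model at fugacity `l`. For every vertex `v` the mean
of `D * 1[v ∈ I] + |I ∩ N(v)|` is at least `K` (`vertex_bound`). Indeed, condition on `I` outside
the closed neighbourhood of `v`: if many neighbours remain available, sparsity makes `|I ∩ N(v)|`
large on average; if few do, `v` itself is likely enough to be chosen. Summing over `v` gives a set
with `2 * D * |I| ≥ K * n!` (`exists_large_indep`).

For sparsity, an exponential-moment (Chernoff) bound on the overlap of supports shows that only a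
fraction `q ^ r` of the pairs in a ball are close, up to a polynomial factor, with `q < 1`
(`card_closePairs_le`). This permits `K` linear in `r`, hence in `n`, while `log₂ V₂(n, r) ≤ n`. -/

/-! ### Large independent sets in graphs with sparse neighbourhoods, by the hard-core model. -/

section IndependentSets

variable {V : Type*} [Fintype V] [DecidableEq V] (G : SimpleGraph V) [DecidableRel G.Adj]

/-- The independent subsets of a finite set of vertices. -/
def indepSubsets (F : Finset V) : Finset (Finset V) :=
  {I ∈ F.powerset | ∀ x ∈ I, ∀ y ∈ I, ¬ G.Adj x y}

variable {G}

theorem mem_indepSubsets {F I : Finset V} :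
    I ∈ indepSubsets G F ↔ I ⊆ F ∧ ∀ x ∈ I, ∀ y ∈ I, ¬ G.Adj x y := by
  simp [indepSubsets]

theorem indepSubsets_downward {F I J : Finset V} (h : I ∈ indepSubsets G F) (hJ : J ⊆ I) :
    J ∈ indepSubsets G F := by
  rw [mem_indepSubsets] at h ⊢
  exact ⟨hJ.trans h.1, fun x hx y hy => h.2 x (hJ hx) y (hJ hy)⟩

variable (G) in
/-- The hard-core partition function of the graph induced on `F`, at fugacity `l`. -/
noncomputable def hardCore (F : Finset V) (l : ℝ) : ℝ := ∑ I ∈ indepSubsets G F, l ^ I.card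

theorem one_le_hardCore (F : Finset V) {l : ℝ} (hl : 0 ≤ l) : 1 ≤ hardCore G F l := by
  have h : (∅ : Finset V) ∈ indepSubsets G F := by simp [mem_indepSubsets]
  simpa [hardCore] using
    Finset.single_le_sum (f := fun I : Finset V => l ^ I.card) (fun I _ => by positivity) h

theorem hardCore_le_exp (F : Finset V) {l : ℝ} (hl : 0 ≤ l) :
    hardCore G F l ≤ Real.exp (l * F.card) := by
  calc hardCore G F l ≤ ∑ I ∈ F.powerset, l ^ I.card :=
        Finset.sum_le_sum_of_subset_of_nonneg (Finset.filter_subset _ _)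
          (fun _ _ _ => by positivity)
    _ = (l + 1) ^ F.card := by simpa using Finset.sum_pow_mul_eq_add_pow l 1 F
    _ ≤ (Real.exp l) ^ F.card := by gcongr; exact Real.add_one_le_exp l
    _ = Real.exp (l * F.card) := by rw [← Real.exp_nat_mul, mul_comm]

/-- The independent subsets containing `u` are those avoiding `u` and its neighbours, with `u`
added. -/
theorem sum_indepSubsets_mem (F : Finset V) (l : ℝ) {u : V} (hu : u ∈ F) :
    ∑ I ∈ indepSubsets G F with u ∈ I, l ^ I.card =
      l * ∑ I ∈ indepSubsets G F with u ∉ I ∧ ∀ w ∈ I, ¬ G.Adj u w, l ^ I.card := by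
  rw [Finset.mul_sum]
  refine Finset.sum_bij' (fun I _ => I.erase u) (fun I _ => insert u I) ?_ ?_ ?_ ?_ ?_
  · intro I hI
    simp only [Finset.mem_filter] at hI ⊢
    refine ⟨indepSubsets_downward hI.1 (Finset.erase_subset _ _), by simp, fun w hw => ?_⟩
    exact (mem_indepSubsets.1 hI.1).2 u hI.2 w (Finset.mem_of_mem_erase hw)
  · intro I hI
    simp only [Finset.mem_filter, mem_indepSubsets] at hI ⊢
    obtain ⟨⟨h1, h2⟩, h3, h4⟩ := hI
    refine ⟨⟨Finset.insert_subset hu h1, fun x hx y hy => ?_⟩, by simp⟩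
    rw [Finset.mem_insert] at hx hy
    rcases hx with rfl | hx <;> rcases hy with rfl | hy
    · simp
    · exact h4 y hy
    · exact fun h => h4 x hx h.symm
    · exact h2 x hx y hy
  · intro I hI
    exact Finset.insert_erase (Finset.mem_filter.1 hI).2
  · intro I hI
    exact Finset.erase_insert (Finset.mem_filter.1 hI).2.1
  · intro I hI
    rw [← pow_succ', Finset.card_erase_add_one (Finset.mem_filter.1 hI).2]

theorem sum_indepSubsets_mem_le (F : Finset V) {l : ℝ} (hl : 0 ≤ l) {u : V} (hu : u ∈ F) :
    ∑ I ∈ indepSubsets G F with u ∈ I, l ^ I.card ≤ l * hardCore G F l := by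
  rw [sum_indepSubsets_mem F l hu]
  gcongr
  exact Finset.sum_le_sum_of_subset_of_nonneg (Finset.filter_subset _ _)
    (fun _ _ _ => by positivity)

/-- Union bound: an independent set contains `u`, or can be extended by `u`, or contains a neighbour
of `u` in `F`. The extendable sets weigh `1 / l` times those containing `u`, and each neighbour
contributes at most `l` times the partition function. -/
theorem le_sum_indepSubsets_mem (F : Finset V) {l : ℝ} (hl : 0 ≤ l) {u : V} (hu : u ∈ F) :
    l * hardCore G F l * (1 - l * (G.neighborFinset u ∩ F).card) ≤
      (1 + l) * ∑ I ∈ indepSubsets G F with u ∈ I, l ^ I.card := by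
  set b := ∑ I ∈ indepSubsets G F with u ∉ I ∧ ∀ w ∈ I, ¬ G.Adj u w, l ^ I.card with hb
  have key : hardCore G F l ≤ (∑ I ∈ indepSubsets G F with u ∈ I, l ^ I.card) + b +
      ∑ w ∈ G.neighborFinset u ∩ F, ∑ I ∈ indepSubsets G F with w ∈ I, l ^ I.card := by
    simp only [hb, Finset.sum_filter]
    rw [Finset.sum_comm, ← Finset.sum_add_distrib, ← Finset.sum_add_distrib, hardCore]
    refine Finset.sum_le_sum fun I hI => ?_
    have h0 : 0 ≤ l ^ I.card := by positivity
    have h1 : 0 ≤ ∑ w ∈ G.neighborFinset u ∩ F, if w ∈ I then l ^ I.card else 0 :=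
      Finset.sum_nonneg fun w _ => by split_ifs <;> simp [h0]
    by_cases hu' : u ∈ I
    · simp only [hu', if_true, not_true, false_and, if_false]
      linarith
    by_cases hw : ∀ w ∈ I, ¬ G.Adj u w
    · simp only [hu', if_false, not_false_iff, true_and]
      rw [if_pos (by exact hw)]
      linarith
    · simp only [hu', if_false, hw, and_false]
      push Not at hw
      obtain ⟨w, hw, hadj⟩ := hw
      have : (if w ∈ I then l ^ I.card else 0) ≤
          ∑ w ∈ G.neighborFinset u ∩ F, if w ∈ I then l ^ I.card else 0 :=
        Finset.single_le_sum (f := fun w => if w ∈ I then l ^ I.card else 0)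
          (fun w _ => by split_ifs <;> simp [h0])
          (by simp [hadj, (mem_indepSubsets.1 hI).1 hw])
      rw [if_pos hw] at this
      linarith
  have hsum : ∑ w ∈ G.neighborFinset u ∩ F, ∑ I ∈ indepSubsets G F with w ∈ I, l ^ I.card ≤
      (G.neighborFinset u ∩ F).card * (l * hardCore G F l) := by
    rw [← nsmul_eq_mul]
    exact Finset.sum_le_card_nsmul _ _ _
      fun w hw => sum_indepSubsets_mem_le F hl (Finset.mem_inter.1 hw).2
  rw [sum_indepSubsets_mem F l hu] at key ⊢
  nlinarith [mul_le_mul_of_nonneg_left (key.trans (add_le_add_right hsum _)) hl]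

theorem sum_card_mul_eq (F : Finset V) (l : ℝ) :
    ∑ I ∈ indepSubsets G F, (I.card : ℝ) * l ^ I.card =
      ∑ u ∈ F, ∑ I ∈ indepSubsets G F with u ∈ I, l ^ I.card := by
  simp only [Finset.sum_filter]
  rw [Finset.sum_comm]
  refine Finset.sum_congr rfl fun I hI => ?_
  rw [← Finset.sum_filter, Finset.filter_mem_eq_inter,
    Finset.inter_eq_right.2 (mem_indepSubsets.1 hI).1, Finset.sum_const, nsmul_eq_mul]

/-- In a sparse graph the expected size of a hard-core set is nearly that of a binomial set. -/
theorem le_sum_card_mul (F : Finset V) {l : ℝ} (hl : 0 ≤ l) (hl1 : l ≤ 1)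
    (hE : l ^ 2 * ∑ u ∈ F, ((G.neighborFinset u ∩ F).card : ℝ) ≤ 1) :
    (l * F.card - 1) * hardCore G F l ≤
      2 * ∑ I ∈ indepSubsets G F, (I.card : ℝ) * l ^ I.card := by
  have h : ∑ u ∈ F, l * hardCore G F l * (1 - l * (G.neighborFinset u ∩ F).card) ≤
      ∑ u ∈ F, (1 + l) * ∑ I ∈ indepSubsets G F with u ∈ I, l ^ I.card :=
    Finset.sum_le_sum fun u hu => le_sum_indepSubsets_mem F hl hu
  rw [← Finset.mul_sum, ← Finset.mul_sum, ← sum_card_mul_eq, Finset.sum_sub_distrib,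
    ← Finset.mul_sum] at h
  simp only [Finset.sum_const, nsmul_eq_mul, mul_one] at h
  have hZ := one_le_hardCore (G := G) F hl
  have hS : 0 ≤ ∑ I ∈ indepSubsets G F, (I.card : ℝ) * l ^ I.card :=
    Finset.sum_nonneg fun _ _ => by positivity
  nlinarith [mul_le_mul_of_nonneg_right hE (by linarith : 0 ≤ hardCore G F l)]

/-- The conditional form of the bound at a vertex: `F` holds its available neighbours, the vertex
itself has weight `l`, and `l + hardCore G F l` is the total weight. -/
theorem neighbourhood_bound (F : Finset V) {l D K : ℝ} (hl : 0 ≤ l) (hl1 : l ≤ 1) (hK : 0 ≤ K)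
    (hE : l ^ 2 * ∑ u ∈ F, ((G.neighborFinset u ∩ F).card : ℝ) ≤ 1)
    (hD : Real.exp (6 * K + 1) ≤ l * D) :
    K * (l + hardCore G F l) ≤
      D * l + ∑ I ∈ indepSubsets G F, (I.card : ℝ) * l ^ I.card := by
  have hZ := one_le_hardCore (G := G) F hl
  have hS : 0 ≤ ∑ I ∈ indepSubsets G F, (I.card : ℝ) * l ^ I.card :=
    Finset.sum_nonneg fun _ _ => by positivity
  have h1 := le_sum_card_mul F hl hl1 hE
  have hpos := Real.exp_pos (6 * K + 1)
  have h2 : K * (l + hardCore G F l) ≤ 2 * K * hardCore G F l := by nlinarith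
  -- Above the threshold the mean size is at least `(l * |F| - 1) / 2 ≥ 2 * K`. Below it the
  -- partition function is at most `exp (4 * K + 1)`, and the term `D * l` suffices alone.
  rcases le_total (4 * K + 1) (l * F.card) with h | h
  · nlinarith
  · have h3 : hardCore G F l ≤ Real.exp (4 * K + 1) :=
      (hardCore_le_exp F hl).trans (Real.exp_le_exp.2 h)
    have h4 : 2 * K ≤ Real.exp (2 * K) := by linarith [Real.add_one_le_exp (2 * K)]
    have h5 : 2 * K * hardCore G F l ≤ Real.exp (2 * K) * Real.exp (4 * K + 1) := by gcongr
    rw [← Real.exp_add, show 2 * K + (4 * K + 1) = 6 * K + 1 by ring] at h5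
    linarith

/-- The independent sets with a prescribed trace `J` outside the closed neighbourhood of `v`. -/
theorem indep_fibre_eq (v : V) {J : Finset V}
    (hJ : ∀ x ∈ J, ∀ y ∈ J, ¬ G.Adj x y) (hv : Disjoint J (insert v (G.neighborFinset v))) :
    {I ∈ indepSubsets G Finset.univ | I \ insert v (G.neighborFinset v) = J} =
      insert (insert v J) ((indepSubsets G
        {u ∈ G.neighborFinset v | ∀ x ∈ J, ¬ G.Adj x u}).image (J ∪ ·)) := by
  rw [Finset.disjoint_left] at hv
  ext I
  simp only [Finset.mem_filter, Finset.mem_insert, Finset.mem_image, mem_indepSubsets,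
    Finset.subset_univ, true_and]
  constructor
  · rintro ⟨hI, rfl⟩
    by_cases hvI : v ∈ I
    · left
      ext x
      simp only [Finset.mem_insert, Finset.mem_sdiff, SimpleGraph.mem_neighborFinset, not_or]
      constructor
      · intro hx
        by_cases hxv : x = v
        · exact Or.inl hxv
        · exact Or.inr ⟨hx, hxv, hI v hvI x hx⟩
      · rintro (rfl | h)
        exacts [hvI, h.1]
    · right
      refine ⟨I ∩ G.neighborFinset v, ⟨fun u hu => ?_, fun x hx y hy => ?_⟩, ?_⟩
      · rw [Finset.mem_inter] at hu
        refine Finset.mem_filter.2 ⟨hu.2, fun x hx => hI x (Finset.mem_sdiff.1 hx).1 u hu.1⟩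
      · exact hI x (Finset.mem_inter.1 hx).1 y (Finset.mem_inter.1 hy).1
      · ext x
        simp only [Finset.mem_union, Finset.mem_sdiff, Finset.mem_insert, Finset.mem_inter]
        by_cases hxv : x = v
        · subst hxv; simp [hvI]
        · tauto
  · rintro (rfl | ⟨S, ⟨hS, hS2⟩, rfl⟩)
    · refine ⟨fun x hx y hy => ?_, ?_⟩
      · rw [Finset.mem_insert] at hx hy
        have hn : ∀ z ∈ J, ¬ G.Adj v z := fun z hz h => hv hz (by simp [h])
        rcases hx with rfl | hx <;> rcases hy with rfl | hy
        · simp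
        · exact hn y hy
        · exact fun h => hn x hx h.symm
        · exact hJ x hx y hy
      · ext x
        simp only [Finset.mem_sdiff, Finset.mem_insert] at hv ⊢
        specialize @hv x
        tauto
    · refine ⟨fun x hx y hy => ?_, ?_⟩
      · rw [Finset.mem_union] at hx hy
        rcases hx with hx | hx <;> rcases hy with hy | hy
        · exact hJ x hx y hy
        · exact (Finset.mem_filter.1 (hS hy)).2 x hx
        · exact fun h => (Finset.mem_filter.1 (hS hx)).2 y hy h.symm
        · exact hS2 x hx y hy
      · ext x
        have hSx : x ∈ S → x ∈ G.neighborFinset v := fun h => (Finset.mem_filter.1 (hS h)).1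
        simp only [Finset.mem_sdiff, Finset.mem_insert, Finset.mem_union] at hv ⊢
        specialize @hv x
        tauto

/-- Once the trace `J` is fixed, `I` is either `J` with `v` added or `J` together with an
independent set of neighbours not blocked by `J`. After removing the factor `l ^ |J|`, this is
`neighbourhood_bound`. -/
theorem fibre_bound (v : V) {l D K : ℝ} (hl : 0 ≤ l) (hl1 : l ≤ 1) (hK : 0 ≤ K)
    (hE : l ^ 2 * ∑ u ∈ G.neighborFinset v,
      ((G.neighborFinset u ∩ G.neighborFinset v).card : ℝ) ≤ 1)
    (hD : Real.exp (6 * K + 1) ≤ l * D) {J : Finset V}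
    (hJ : ∀ x ∈ J, ∀ y ∈ J, ¬ G.Adj x y) (hv : Disjoint J (insert v (G.neighborFinset v))) :
    ∑ I ∈ indepSubsets G Finset.univ with I \ insert v (G.neighborFinset v) = J,
        K * l ^ I.card ≤
      ∑ I ∈ indepSubsets G Finset.univ with I \ insert v (G.neighborFinset v) = J,
        ((if v ∈ I then D else 0) + (I ∩ G.neighborFinset v).card) * l ^ I.card := by
  rw [indep_fibre_eq v hJ hv]
  set F := {u ∈ G.neighborFinset v | ∀ x ∈ J, ¬ G.Adj x u} with hF
  have hvJ : v ∉ J := fun h => Finset.disjoint_left.1 hv h (by simp)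
  have hFN : F ⊆ G.neighborFinset v := Finset.filter_subset _ _
  have hJN : Disjoint J (G.neighborFinset v) := hv.mono_right (Finset.subset_insert _ _)
  have hvF : v ∉ F := fun h => by simpa using hFN h
  have hsub : ∀ S ∈ indepSubsets G F, S ⊆ F := fun S hS => (mem_indepSubsets.1 hS).1
  have hdisj : ∀ S ∈ indepSubsets G F, Disjoint J S := fun S hS =>
    hJN.mono_right ((hsub S hS).trans hFN)
  have hnot : insert v J ∉ (indepSubsets G F).image (J ∪ ·) := by
    rw [Finset.mem_image]
    rintro ⟨S, hS, h⟩
    have : v ∈ J ∪ S := by rw [h]; simp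
    rcases Finset.mem_union.1 this with h | h
    exacts [hvJ h, hvF (hsub S hS h)]
  have hinj : Set.InjOn (J ∪ ·) (indepSubsets G F : Set (Finset V)) := by
    intro S hS T hT h
    have h' : (J ∪ S) \ J = (J ∪ T) \ J := by rw [show J ∪ S = J ∪ T from h]
    rwa [Finset.union_sdiff_cancel_left (hdisj S hS),
      Finset.union_sdiff_cancel_left (hdisj T hT)] at h'
  rw [Finset.sum_insert hnot, Finset.sum_insert hnot, Finset.sum_image hinj,
    Finset.sum_image hinj]
  have e1 : (insert v J ∩ G.neighborFinset v).card = 0 := by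
    rw [Finset.insert_inter_of_notMem (by simp), Finset.disjoint_iff_inter_eq_empty.1 hJN,
      Finset.card_empty]
  have e2 : ∑ S ∈ indepSubsets G F, K * l ^ (J ∪ S).card =
      l ^ J.card * (K * hardCore G F l) := by
    rw [hardCore, Finset.mul_sum, Finset.mul_sum]
    refine Finset.sum_congr rfl fun S hS => ?_
    rw [Finset.card_union_of_disjoint (hdisj S hS), pow_add]
    ring
  have e3 : ∑ S ∈ indepSubsets G F, ((if v ∈ J ∪ S then D else 0) +
        ((J ∪ S) ∩ G.neighborFinset v).card) * l ^ (J ∪ S).card =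
      l ^ J.card * ∑ S ∈ indepSubsets G F, (S.card : ℝ) * l ^ S.card := by
    rw [Finset.mul_sum]
    refine Finset.sum_congr rfl fun S hS => ?_
    rw [if_neg, Finset.union_inter_distrib_right, Finset.disjoint_iff_inter_eq_empty.1 hJN,
      Finset.empty_union, Finset.inter_eq_left.2 ((hsub S hS).trans hFN),
      Finset.card_union_of_disjoint (hdisj S hS), pow_add]
    · ring
    · rw [Finset.mem_union]
      rintro (h | h)
      exacts [hvJ h, hvF (hsub S hS h)]
  rw [e1, e2, e3, if_pos (Finset.mem_insert_self _ _), Finset.card_insert_of_notMem hvJ]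
  have hEF : l ^ 2 * ∑ u ∈ F, ((G.neighborFinset u ∩ F).card : ℝ) ≤ 1 := by
    refine le_trans ?_ hE
    gcongr
    refine (Finset.sum_le_sum fun u _ => ?_).trans
      (Finset.sum_le_sum_of_subset_of_nonneg hFN fun _ _ _ => by positivity)
    exact_mod_cast Finset.card_le_card (Finset.inter_subset_inter_left hFN)
  have := mul_le_mul_of_nonneg_left (neighbourhood_bound F hl hl1 hK hEF hD)
    (by positivity : 0 ≤ l ^ J.card)
  push_cast
  linear_combination this

theorem vertex_bound (v : V) {l D K : ℝ} (hl : 0 ≤ l) (hl1 : l ≤ 1) (hK : 0 ≤ K)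
    (hE : l ^ 2 * ∑ u ∈ G.neighborFinset v,
      ((G.neighborFinset u ∩ G.neighborFinset v).card : ℝ) ≤ 1)
    (hD : Real.exp (6 * K + 1) ≤ l * D) :
    ∑ I ∈ indepSubsets G Finset.univ, K * l ^ I.card ≤
      ∑ I ∈ indepSubsets G Finset.univ,
        ((if v ∈ I then D else 0) + (I ∩ G.neighborFinset v).card) * l ^ I.card := by
  have hfib (f : Finset V → ℝ) := Finset.sum_fiberwise (indepSubsets G Finset.univ)
    (fun I => I \ insert v (G.neighborFinset v)) f
  rw [← hfib, ← hfib (fun I => ((if v ∈ I then D else 0) +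
    ((I ∩ G.neighborFinset v).card : ℝ)) * l ^ I.card)]
  refine Finset.sum_le_sum fun J _ => ?_
  by_cases h : ∃ I ∈ indepSubsets G Finset.univ, I \ insert v (G.neighborFinset v) = J
  · obtain ⟨I, hI, hIJ⟩ := h
    refine fibre_bound v hl hl1 hK hE hD ?_ ?_
    · rw [← hIJ]
      exact (mem_indepSubsets.1 (indepSubsets_downward hI Finset.sdiff_subset)).2
    · rw [← hIJ]
      exact Finset.sdiff_disjoint
  · rw [Finset.filter_false_of_mem fun I hI hIJ => h ⟨I, hI, hIJ⟩]
    simp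

/-- A graph of maximum degree at most `D` with sparse neighbourhoods has an independent set that
is larger than the greedy one by a logarithmic factor. -/
theorem exists_large_indep {l D K : ℝ} (hl : 0 < l) (hl1 : l ≤ 1) (hK : 0 ≤ K)
    (hdeg : ∀ v, (G.degree v : ℝ) ≤ D)
    (hE : ∀ v, l ^ 2 * ∑ u ∈ G.neighborFinset v,
      ((G.neighborFinset u ∩ G.neighborFinset v).card : ℝ) ≤ 1)
    (hD : Real.exp (6 * K + 1) ≤ l * D) :
    ∃ I : Finset V, (∀ x ∈ I, ∀ y ∈ I, ¬ G.Adj x y) ∧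
      Fintype.card V * K ≤ 2 * D * I.card := by
  by_contra! hcon
  have h1 := Finset.sum_le_sum fun v (_ : v ∈ (Finset.univ : Finset V)) =>
    vertex_bound v hl.le hl1 hK (hE v) hD
  -- With `I` fixed, the sum over `v` is `D * |I|` plus the degrees of the members of `I`, hence at
  -- most `2 * D * |I|`.
  rw [Finset.sum_comm, Finset.sum_comm (s := Finset.univ)] at h1
  refine absurd h1 (not_le.2 (Finset.sum_lt_sum_of_nonempty
    ⟨∅, by simp [mem_indepSubsets]⟩ fun I hI => ?_))
  rw [Finset.sum_const, nsmul_eq_mul, ← Finset.sum_mul, ← mul_assoc]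
  refine mul_lt_mul_of_pos_right (lt_of_le_of_lt ?_
    (hcon I (mem_indepSubsets.1 hI).2)) (by positivity)
  rw [Finset.sum_add_distrib]
  have e1 : ∑ v : V, (if v ∈ I then D else 0) = I.card * D := by
    simp
  have e2 : ∑ v : V, ((I ∩ G.neighborFinset v).card : ℝ) = ∑ u ∈ I, (G.degree u : ℝ) := by
    have (v : V) : ((I ∩ G.neighborFinset v).card : ℝ) = ∑ u ∈ I, if G.Adj u v then 1 else 0 := by
      rw [← Finset.sum_filter, Finset.sum_const, nsmul_eq_mul, mul_one]
      congr 2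
      ext u
      simp [G.adj_comm]
    simp_rw [this]
    rw [Finset.sum_comm]
    refine Finset.sum_congr rfl fun u _ => ?_
    rw [← Finset.sum_filter, Finset.sum_const, nsmul_eq_mul, mul_one, ← G.card_neighborFinset_eq_degree]
    congr 2
    ext v
    simp
  have e3 : ∑ u ∈ I, (G.degree u : ℝ) ≤ I.card * D := by
    rw [← nsmul_eq_mul]
    exact Finset.sum_le_card_nsmul _ _ _ fun u _ => hdeg u
  rw [e1, e2]
  linarith [Finset.card_univ (α := V)]

end IndependentSets

/-! ### Counting permutations by their supports. -/

theorem card_perm_support_eq {α : Type*} [Fintype α] [DecidableEq α] (A : Finset α) :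
    (Finset.univ.filter fun f : Equiv.Perm α => f.support = A).card = numDerangements A.card := by
  rw [← Fintype.card_coe A, ← card_derangements_eq_numDerangements,
    Fintype.card_congr (derangements.subtypeEquiv (· ∈ A)), Fintype.card_subtype]
  congr 1
  ext f
  simp only [Finset.mem_filter, Finset.mem_univ, true_and, Finset.ext_iff,
    Equiv.Perm.mem_support, Function.mem_fixedPoints, Function.IsFixedPt]
  exact forall_congr' fun a => by tauto

theorem sum_perm_support {α : Type*} [Fintype α] [DecidableEq α] (g : Finset α → ℝ) :
    ∑ f : Equiv.Perm α, g f.support = ∑ A : Finset α, (numDerangements A.card : ℝ) * g A := by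
  rw [← Finset.sum_fiberwise Finset.univ Equiv.Perm.support]
  refine Finset.sum_congr rfl fun A _ => ?_
  rw [← card_perm_support_eq, ← nsmul_eq_mul, ← Finset.sum_const]
  exact Finset.sum_congr rfl fun f hf => by rw [(Finset.mem_filter.1 hf).2]

/-- Summation over finite sets of size at most `r`, organised by size. -/
theorem sum_card_le_eq {α : Type*} [Fintype α] [DecidableEq α] (r : ℕ)
    (f : Finset α → ℝ) :
    ∑ A : Finset α with A.card ≤ r, f A =
      ∑ a ∈ Finset.range (r + 1), ∑ A ∈ Finset.univ.powersetCard a, f A := by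
  rw [← Finset.sum_fiberwise_of_maps_to (t := Finset.range (r + 1)) (g := Finset.card)
    (fun A hA => by simpa [Nat.lt_succ_iff] using hA)]
  refine Finset.sum_congr rfl fun a ha => Finset.sum_congr ?_ fun _ _ => rfl
  ext A
  simp only [Finset.mem_filter, Finset.mem_univ, true_and, Finset.mem_powersetCard,
    Finset.subset_univ]
  have := Finset.mem_range.1 ha
  constructor
  · exact fun h => h.2
  · exact fun h => ⟨by omega, h⟩

theorem sum_card_le_numDerangements_mul (n r : ℕ) (g : ℕ → ℝ) :
    ∑ A : Finset (Fin n) with A.card ≤ r, (numDerangements A.card : ℝ) * g A.card =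
      ∑ a ∈ Finset.range (r + 1), ((n.choose a * numDerangements a : ℕ) : ℝ) * g a := by
  rw [sum_card_le_eq]
  refine Finset.sum_congr rfl fun a _ => ?_
  rw [Finset.sum_congr rfl fun A hA => by rw [(Finset.mem_powersetCard.1 hA).2],
    Finset.sum_const, Finset.card_powersetCard, Finset.card_univ, Fintype.card_fin, nsmul_eq_mul]
  push_cast
  ring

theorem sum_perm_ball (n r : ℕ) (g : Finset (Fin n) → ℝ) :
    ∑ f : Equiv.Perm (Fin n) with f.support.card ≤ r, g f.support =
      ∑ A : Finset (Fin n) with A.card ≤ r, (numDerangements A.card : ℝ) * g A := by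
  rw [Finset.sum_filter, Finset.sum_filter,
    sum_perm_support fun A => if A.card ≤ r then g A else 0]
  simp only [mul_ite, mul_zero]

theorem card_perm_ball (n r : ℕ) :
    (Finset.univ.filter fun f : Equiv.Perm (Fin n) => f.support.card ≤ r).card =
      permBallVol n r := by
  have h := sum_perm_ball n r fun _ => 1
  have h' := sum_card_le_numDerangements_mul n r fun _ => 1
  rw [h', Finset.sum_const, nsmul_eq_mul] at h
  simp only [mul_one] at h
  rw [permBallVol]
  exact_mod_cast h

/-! ### Exponential moments of the intersection with a random set. -/

/-- A random `a`-subset contains `t` given points with probability at most `(a / n) ^ t`, since `(a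
- i) / (n - i) ≤ a / n` for each `i`. -/
theorem choose_sub_mul_pow_le {n a t : ℕ} (hta : t ≤ a) (han : a ≤ n) :
    (n - t).choose (a - t) * n ^ t ≤ n.choose a * a ^ t := by
  induction t with
  | zero => simp
  | succ t ih =>
    have ih := ih (by omega)
    obtain ⟨k, hk⟩ : ∃ k, a - t = k + 1 := ⟨a - t - 1, by omega⟩
    obtain ⟨m, hm⟩ : ∃ m, n - t = m + 1 := ⟨n - t - 1, by omega⟩
    rw [hk, hm] at ih
    rw [show a - (t + 1) = k by omega, show n - (t + 1) = m by omega]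
    have h := Nat.add_one_mul_choose_eq m k
    have hle : (k + 1) * n ≤ (m + 1) * a := by
      rw [← hk, ← hm]
      zify [show t ≤ a by omega, show t ≤ n by omega]
      nlinarith
    refine Nat.le_of_mul_le_mul_left (c := m + 1) ?_ (by omega)
    calc (m + 1) * (m.choose k * n ^ (t + 1)) = (m + 1).choose (k + 1) * n ^ t * ((k + 1) * n) := by
          rw [← mul_assoc, h]; ring
      _ ≤ n.choose a * a ^ t * ((m + 1) * a) := Nat.mul_le_mul ih hle
      _ = _ := by ring

/-- The moment generating function of a hypergeometric variable is at most that of the binomial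
variable with the same mean. -/
theorem hypergeometric_mgf_le {α : Type*} [Fintype α] [DecidableEq α] (B : Finset α) {a : ℕ}
    (ha : a ≤ Fintype.card α) {y : ℝ} (hy : 0 ≤ y) :
    ∑ A ∈ Finset.univ.powersetCard a, (1 + y) ^ (A ∩ B).card ≤
      (Fintype.card α).choose a * (1 + y * (a / Fintype.card α)) ^ B.card := by
  set n := Fintype.card α with hn
  have expand (C : Finset α) (z : ℝ) : (1 + z) ^ C.card = ∑ T ∈ C.powerset, z ^ T.card := by
    rw [add_comm]
    simpa using (Finset.sum_pow_mul_eq_add_pow z 1 C).symm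
  -- Expanding `(1 + y) ^ |A ∩ B|` over the subsets `T` of `A ∩ B` reduces the claim to counting the
  -- sets `A` that contain `T`.
  have h1 : ∑ A ∈ (Finset.univ : Finset α).powersetCard a, (1 + y) ^ (A ∩ B).card =
      ∑ T ∈ B.powerset, ∑ A ∈ (Finset.univ : Finset α).powersetCard a,
        if T ⊆ A then y ^ T.card else 0 := by
    rw [Finset.sum_comm]
    refine Finset.sum_congr rfl fun A _ => ?_
    rw [expand, ← Finset.sum_filter]
    refine Finset.sum_congr ?_ fun _ _ => rfl
    ext T
    simp only [Finset.mem_powerset, Finset.mem_filter, Finset.subset_inter_iff]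
    tauto
  rw [h1, expand, Finset.mul_sum]
  refine Finset.sum_le_sum fun T _ => ?_
  rw [← Finset.sum_filter, Finset.sum_const, nsmul_eq_mul, mul_pow, mul_left_comm, mul_comm]
  refine mul_le_mul_of_nonneg_left ?_ (by positivity)
  have hcard : (((Finset.univ : Finset α).powersetCard a).filter (T ⊆ ·)).card * n ^ T.card ≤
      n.choose a * a ^ T.card := by
    by_cases hT : T.card ≤ a
    · refine le_trans (Nat.mul_le_mul_right _ ?_) (choose_sub_mul_pow_le hT ha)
      rw [hn, ← Finset.card_univ, ← Finset.card_sdiff_of_subset (Finset.subset_univ T),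
        ← Finset.card_powersetCard]
      refine Finset.card_le_card_of_injOn (· \ T) (fun A hA => ?_) (fun A hA A' hA' h => ?_)
      · simp only [Finset.coe_filter, Finset.mem_powersetCard, Set.mem_ofPred_eq] at hA
        simp only [Finset.mem_coe, Finset.mem_powersetCard]
        exact ⟨Finset.sdiff_subset_sdiff hA.1.1 le_rfl, by
          rw [Finset.card_sdiff_of_subset hA.2, hA.1.2]⟩
      · simp only [Finset.coe_filter, Set.mem_ofPred_eq] at hA hA'
        rw [← Finset.sdiff_union_of_subset hA.2, show A \ T = A' \ T from h,
          Finset.sdiff_union_of_subset hA'.2]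
    · rw [Finset.filter_false_of_mem]
      · simp
      · intro A hA h
        exact hT ((Finset.card_le_card h).trans_eq (Finset.mem_powersetCard.1 hA).2)
  -- For `n = 0` the quotient `a / n` is the default `0`, but then `T` is empty and the power is
  -- `1`.
  rcases Nat.eq_zero_or_pos n with h0 | h0
  · have : T.card = 0 := by
      have := Finset.card_le_univ T
      omega
    rw [this] at hcard ⊢
    simp only [pow_zero, mul_one] at hcard ⊢
    exact_mod_cast hcard
  · rw [div_pow, ← mul_div_assoc, le_div_iff₀ (by positivity)]
    exact_mod_cast hcard

/-! ### Growth of spheres in the symmetric group. -/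

theorem mul_numDerangements_le (a : ℕ) : a * numDerangements a ≤ numDerangements (a + 1) := by
  cases a with
  | zero => simp
  | succ a => rw [numDerangements_add_two]; nlinarith

/-- Consecutive spheres in `S_n` grow at least by a factor `n / 4`, up to radius `n / 2`. -/
theorem sphere_growth {n a : ℕ} (ha : 1 ≤ a) (han : 2 * (a + 1) ≤ n) :
    n * (n.choose a * numDerangements a) ≤
      4 * (n.choose (a + 1) * numDerangements (a + 1)) := by
  have h1 := Nat.choose_succ_right_eq n a
  have h2 := mul_numDerangements_le a
  refine Nat.le_of_mul_le_mul_left (c := a + 1) ?_ (by omega)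
  obtain ⟨m, hm⟩ : ∃ m, n = a + m := ⟨n - a, by omega⟩
  rw [show n - a = m by omega] at h1
  calc (a + 1) * (n * (n.choose a * numDerangements a))
      = ((a + 1) * n) * (n.choose a * numDerangements a) := by ring
    _ ≤ (4 * (m * a)) * (n.choose a * numDerangements a) := by
        refine Nat.mul_le_mul_right _ ?_
        nlinarith
    _ = 4 * ((n.choose a * m) * (a * numDerangements a)) := by ring
    _ ≤ 4 * ((n.choose a * m) * numDerangements (a + 1)) := by gcongr
    _ = _ := by rw [← h1]; ring

theorem sphere_mul_pow_le {n r a : ℕ} {M : ℝ} (hM : 0 ≤ M) (hMn : 4 * M ≤ n)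
    (hr : 2 ≤ r) (hrn : 2 * r ≤ n) (har : a ≤ r) :
    ((n.choose a * numDerangements a : ℕ) : ℝ) * M ^ (r - a) ≤
      ((n.choose r * numDerangements r : ℕ) : ℝ) := by
  have step (b : ℕ) (hb : 1 ≤ b) (hbr : b ≤ r) :
      ((n.choose b * numDerangements b : ℕ) : ℝ) * M ^ (r - b) ≤
        ((n.choose r * numDerangements r : ℕ) : ℝ) := by
    induction hbr using Nat.decreasingInduction with
    | self => simp
    | of_succ b hbr ih =>
      refine le_trans ?_ (ih (by omega))
      rw [show r - b = (r - (b + 1)) + 1 by omega, pow_succ', ← mul_assoc]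
      refine mul_le_mul_of_nonneg_right ?_ (by positivity)
      have h : (n : ℝ) * ((n.choose b * numDerangements b : ℕ) : ℝ) ≤
          4 * ((n.choose (b + 1) * numDerangements (b + 1) : ℕ) : ℝ) := by
        exact_mod_cast sphere_growth hb (by omega)
      have h0 : (0 : ℝ) ≤ ((n.choose b * numDerangements b : ℕ) : ℝ) := by positivity
      nlinarith
  -- The sphere of radius 1 is empty because `D_1 = 0`, so radius 0 is compared directly with radius
  -- 2.
  rcases Nat.eq_zero_or_pos a with rfl | ha
  · refine le_trans ?_ (step 2 (by omega) hr)
    rw [Nat.sub_zero, show r = 2 + (r - 2) by omega, pow_add, ← mul_assoc,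
      show 2 + (r - 2) - 2 = r - 2 by omega]
    refine mul_le_mul_of_nonneg_right ?_ (by positivity)
    have h2 : ((n.choose 2 * numDerangements 2 : ℕ) : ℝ) = n * (n - 1) / 2 := by
      rw [show numDerangements 2 = 1 from rfl, mul_one, Nat.cast_choose_two]
    rw [h2]
    have : (4 : ℝ) ≤ n := by exact_mod_cast (by omega : 4 ≤ n)
    simp only [Nat.choose_zero_right, numDerangements_zero, mul_one, Nat.cast_one, one_mul]
    nlinarith
  · exact step a ha har

theorem sphere_le_permBallVol {n r a : ℕ} (har : a ≤ r) :
    n.choose a * numDerangements a ≤ permBallVol n r :=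
  Finset.single_le_sum (f := fun i => n.choose i * numDerangements i) (fun _ _ => Nat.zero_le _)
    (Finset.mem_range.2 (Nat.lt_succ_of_le har))

theorem sum_sphere_mul_pow_le {n r : ℕ} {M : ℝ} (hM : 0 ≤ M) (hMn : 4 * M ≤ n)
    (hr : 2 ≤ r) (hrn : 2 * r ≤ n) :
    ∑ a ∈ Finset.range (r + 1), ((n.choose a * numDerangements a : ℕ) : ℝ) * M ^ (r - a) ≤
      (n + 1) * permBallVol n r := by
  calc _ ≤ ∑ a ∈ Finset.range (r + 1), (permBallVol n r : ℝ) := by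
        refine Finset.sum_le_sum fun a ha => ?_
        refine (sphere_mul_pow_le hM hMn hr hrn (by simpa [Nat.lt_succ_iff] using ha)).trans ?_
        exact_mod_cast sphere_le_permBallVol le_rfl
    _ = (r + 1) * permBallVol n r := by simp
    _ ≤ _ := by
        have : (r : ℝ) ≤ n := by exact_mod_cast (by omega : r ≤ n)
        gcongr

/-! ### Close pairs inside a ball. -/

/-- Pairs of permutations in the ball of radius `r`, at distance at most `r` from each other. -/
def closePairs (n r : ℕ) : Finset (Equiv.Perm (Fin n) × Equiv.Perm (Fin n)) :=
  {p | p.1.support.card ≤ r ∧ p.2.support.card ≤ r ∧ (p.1⁻¹ * p.2).support.card ≤ r}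

/-- A point moved by exactly one of `f` and `g` has different images under them, so the symmetric
difference of the supports lies in the support of `f⁻¹ * g`. -/
theorem support_card_add_le {n : ℕ} (f g : Equiv.Perm (Fin n)) :
    f.support.card + g.support.card ≤
      (f⁻¹ * g).support.card + 2 * (f.support ∩ g.support).card := by
  have h1 : f.support \ g.support ∪ g.support \ f.support ⊆ (f⁻¹ * g).support := by
    intro x hx
    simp only [Finset.mem_union, Finset.mem_sdiff, Equiv.Perm.mem_support, not_not, ne_eq,
      Equiv.Perm.mul_apply, Equiv.Perm.inv_eq_iff_eq] at hx ⊢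
    rcases hx with ⟨h, h'⟩ | ⟨h, h'⟩
    · rw [h']; exact fun e => h e.symm
    · rw [h']; exact h
  have h2 := Finset.card_le_card h1
  rw [Finset.card_union_of_disjoint (by
    rw [Finset.disjoint_left]; intro x hx hx'
    exact (Finset.mem_sdiff.1 hx').2 (Finset.mem_sdiff.1 hx).1)] at h2
  have h3 := Finset.card_sdiff_add_card_inter f.support g.support
  have h4 := Finset.card_sdiff_add_card_inter g.support f.support
  rw [Finset.inter_comm g.support] at h4
  omega

/-- Chernoff's method with parameter `s`. Each point of the second support costs `(1 + (s ^ 2 - 1) *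
α) / s ≤ q`; supports smaller than `r` lose some of this gain, but the growth of spheres makes up
for it. -/
theorem card_closePairs_le {n r : ℕ} {α s q : ℝ} (hα : 0 ≤ α) (hs : 1 ≤ s) (hq : 0 < q)
    (hsq : 1 + (s ^ 2 - 1) * α ≤ q * s) (hrα : r ≤ α * n) (hsn : 4 * s ≤ n)
    (hqn : 4 * q⁻¹ ≤ n) (hr : 2 ≤ r) (hrn : 2 * r ≤ n) :
    ((closePairs n r).card : ℝ) ≤ ((n + 1) * permBallVol n r) ^ 2 * q ^ r := by
  have hs0 : 0 < s := by linarith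
  have hn0 : (0 : ℝ) < n := by linarith
  set c := 1 + (s ^ 2 - 1) * α with hc
  have hs2 : 0 ≤ s ^ 2 - 1 := by nlinarith
  have hc0 : 0 < c := by positivity
  have inner (B : Finset (Fin n)) :
      ∑ A : Finset (Fin n) with A.card ≤ r,
        (numDerangements A.card : ℝ) * (s ^ (r - A.card) * (s ^ 2) ^ (A ∩ B).card) ≤
      (n + 1) * permBallVol n r * c ^ B.card := by
    rw [sum_card_le_eq]
    refine le_trans (Finset.sum_le_sum (g := fun a =>
      ((n.choose a * numDerangements a : ℕ) : ℝ) * s ^ (r - a) * c ^ B.card) fun a ha => ?_) ?_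
    · have har : a ≤ r := by simpa [Nat.lt_succ_iff] using ha
      have hcard : ∀ A ∈ (Finset.univ : Finset (Fin n)).powersetCard a,
          (numDerangements A.card : ℝ) * (s ^ (r - A.card) * (s ^ 2) ^ (A ∩ B).card) =
          numDerangements a * s ^ (r - a) * (1 + (s ^ 2 - 1)) ^ (A ∩ B).card := by
        intro A hA
        rw [(Finset.mem_powersetCard.1 hA).2, add_sub_cancel, mul_assoc]
      rw [Finset.sum_congr rfl hcard, ← Finset.mul_sum]
      have h := hypergeometric_mgf_le B (a := a) (by rw [Fintype.card_fin]; omega) hs2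
      rw [Fintype.card_fin] at h
      have h' : (1 + (s ^ 2 - 1) * ((a : ℝ) / n)) ^ B.card ≤ c ^ B.card := by
        have : (a : ℝ) / n ≤ α := by
          rw [div_le_iff₀ hn0]
          exact le_trans (by exact_mod_cast har) hrα
        rw [hc]
        gcongr
      calc _ ≤ numDerangements a * s ^ (r - a) * (n.choose a * c ^ B.card) := by
            refine mul_le_mul_of_nonneg_left (h.trans ?_) (by positivity)
            gcongr
        _ = _ := by push_cast; ring
    · rw [← Finset.sum_mul]
      exact mul_le_mul_of_nonneg_right (sum_sphere_mul_pow_le hs0.le hsn hr hrn) (by positivity)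
  calc ((closePairs n r).card : ℝ)
      = ∑ p ∈ closePairs n r, (1 : ℝ) := by simp
    -- By `support_card_add_le` the total exponent of `s` is nonnegative on close pairs, so each
    -- weight is at least 1.
    _ ≤ ∑ p ∈ closePairs n r, s⁻¹ ^ p.2.support.card *
          (s ^ (r - p.1.support.card) * (s ^ 2) ^ (p.1.support ∩ p.2.support).card) := by
        refine Finset.sum_le_sum fun p hp => ?_
        simp only [closePairs, Finset.mem_filter, Finset.mem_univ, true_and] at hp
        have h := support_card_add_le p.1 p.2
        rw [inv_pow, ← pow_mul, ← pow_add, le_inv_mul_iff₀ (by positivity), mul_one]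
        exact pow_le_pow_right₀ hs (by omega)
    _ ≤ ∑ p ∈ (Finset.univ.filter fun f : Equiv.Perm (Fin n) => f.support.card ≤ r) ×ˢ
          (Finset.univ.filter fun f : Equiv.Perm (Fin n) => f.support.card ≤ r),
          s⁻¹ ^ p.2.support.card *
          (s ^ (r - p.1.support.card) * (s ^ 2) ^ (p.1.support ∩ p.2.support).card) := by
        refine Finset.sum_le_sum_of_subset_of_nonneg (fun p hp => ?_) fun _ _ _ => by positivity
        simp only [closePairs, Finset.mem_filter, Finset.mem_univ, true_and] at hp
        simp [hp.1, hp.2.1]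
    _ ≤ ∑ g : Equiv.Perm (Fin n) with g.support.card ≤ r,
          s⁻¹ ^ g.support.card * ((n + 1) * permBallVol n r * c ^ g.support.card) := by
        rw [Finset.sum_product_right]
        refine Finset.sum_le_sum fun g _ => ?_
        dsimp only
        rw [← Finset.mul_sum]
        refine mul_le_mul_of_nonneg_left ?_ (by positivity)
        rw [sum_perm_ball n r fun A => s ^ (r - A.card) * (s ^ 2) ^ (A ∩ g.support).card]
        exact inner _
    -- Writing `q ^ |supp g|` as `q ^ r` times a power of `q⁻¹` leaves a sum that
    -- `sum_sphere_mul_pow_le` controls.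
    _ ≤ ∑ g : Equiv.Perm (Fin n) with g.support.card ≤ r,
          (n + 1) * permBallVol n r * q ^ r * q⁻¹ ^ (r - g.support.card) := by
        refine Finset.sum_le_sum fun g hg => ?_
        have hg : g.support.card ≤ r := by simpa using hg
        have e : q ^ r * q⁻¹ ^ (r - g.support.card) = q ^ g.support.card := by
          rw [inv_pow, ← div_eq_mul_inv, div_eq_iff (by positivity), ← pow_add]
          congr 1; omega
        have : s⁻¹ ^ g.support.card * c ^ g.support.card ≤ q ^ g.support.card := by
          rw [← mul_pow]
          gcongr
          rw [inv_mul_le_iff₀ hs0]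
          linarith
        calc _ = (n + 1) * permBallVol n r * (s⁻¹ ^ g.support.card * c ^ g.support.card) := by ring
          _ ≤ (n + 1) * permBallVol n r * q ^ g.support.card := by gcongr
          _ = _ := by rw [← e]; ring
    _ = (n + 1) * permBallVol n r * q ^ r * ∑ a ∈ Finset.range (r + 1),
          ((n.choose a * numDerangements a : ℕ) : ℝ) * q⁻¹ ^ (r - a) := by
        rw [← Finset.mul_sum, sum_perm_ball n r fun A => q⁻¹ ^ (r - A.card),
          sum_card_le_numDerangements_mul n r fun a => q⁻¹ ^ (r - a)]
    _ ≤ (n + 1) * permBallVol n r * q ^ r * ((n + 1) * permBallVol n r) := by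
        gcongr
        exact sum_sphere_mul_pow_le (by positivity) hqn hr hrn
    _ = _ := by ring

/-! ### The distance graph on permutations. -/

theorem hammingDist_perm {n : ℕ} (f g : Equiv.Perm (Fin n)) :
    hammingDist (f : Fin n → Fin n) (g : Fin n → Fin n) = (f⁻¹ * g).support.card := by
  rw [hammingDist]
  congr 1
  ext x
  simp only [Finset.mem_filter, Finset.mem_univ, true_and, Equiv.Perm.mem_support,
    Equiv.Perm.mul_apply, ne_eq, Equiv.Perm.inv_eq_iff_eq]
  exact not_congr eq_comm

theorem card_support_inv_mul_comm {n : ℕ} (f g : Equiv.Perm (Fin n)) :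
    (f⁻¹ * g).support.card = (g⁻¹ * f).support.card := by
  rw [← hammingDist_perm, ← hammingDist_perm, hammingDist_comm]

/-- Distinct permutations at Hamming distance at most `r`. -/
def permGraph (n r : ℕ) : SimpleGraph (Equiv.Perm (Fin n)) where
  Adj f g := f ≠ g ∧ (f⁻¹ * g).support.card ≤ r
  symm := ⟨fun f g h => ⟨h.1.symm, card_support_inv_mul_comm f g ▸ h.2⟩⟩
  loopless := ⟨fun _ h => h.1 rfl⟩

instance (n r : ℕ) : DecidableRel (permGraph n r).Adj :=
  fun f g => inferInstanceAs (Decidable (f ≠ g ∧ (f⁻¹ * g).support.card ≤ r))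

theorem permGraph_degree_le (n r : ℕ) (f : Equiv.Perm (Fin n)) :
    (permGraph n r).degree f ≤ permBallVol n r := by
  rw [← SimpleGraph.card_neighborFinset_eq_degree, ← card_perm_ball]
  refine Finset.card_le_card_of_injOn (f⁻¹ * ·) (fun g hg => ?_)
    (fun g _ g' _ h => mul_left_cancel h)
  have hg : (permGraph n r).Adj f g := by simpa using hg
  simpa using hg.2

/-- Left translation by `f⁻¹` preserves distances and carries the neighbourhood of `f` into the ball
about the identity. -/
theorem permGraph_codegree_le (n r : ℕ) (f : Equiv.Perm (Fin n)) :
    ∑ g ∈ (permGraph n r).neighborFinset f,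
      ((permGraph n r).neighborFinset g ∩ (permGraph n r).neighborFinset f).card ≤
        (closePairs n r).card := by
  rw [← Finset.card_sigma]
  refine Finset.card_le_card_of_injOn (fun p => (f⁻¹ * p.1, f⁻¹ * p.2)) ?_ ?_
  · rintro ⟨g, h⟩ hp
    simp only [Finset.mem_coe, Finset.mem_sigma, Finset.mem_inter,
      SimpleGraph.mem_neighborFinset] at hp
    simp only [closePairs, Finset.coe_filter, Finset.mem_univ, true_and, Set.mem_ofPred_eq]
    refine ⟨hp.1.2, hp.2.2.2, ?_⟩
    rw [show (f⁻¹ * g)⁻¹ * (f⁻¹ * h) = g⁻¹ * h by group]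
    exact hp.2.1.2
  · rintro ⟨g, h⟩ _ ⟨g', h'⟩ _ e
    simp only [Prod.mk.injEq, mul_right_inj] at e
    rw [e.1, e.2]

/-! ### The lower bound and the choice of constants. -/

theorem IsPermArray.card_le_maxPermArray {n d : ℕ} {C : Finset (Equiv.Perm (Fin n))}
    (hC : IsPermArray n d C) : C.card ≤ maxPermArray n d :=
  Finset.le_sup (f := Finset.card) (by simpa using hC)

theorem one_le_maxPermArray (n d : ℕ) : 1 ≤ maxPermArray n d := by
  refine le_trans ?_ (IsPermArray.card_le_maxPermArray (C := {1}) ?_)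
  · simp
  · simp [IsPermArray]

theorem one_le_permBallVol (n r : ℕ) : 1 ≤ permBallVol n r := by
  simpa using sphere_le_permBallVol (n := n) (Nat.zero_le r)

theorem logb_binBallVol_le (n r : ℕ) : Real.logb 2 (binBallVol n r) ≤ n := by
  have h1 : binBallVol n r ≤ 2 ^ n := by
    rw [binBallVol, ← Nat.sum_range_choose]
    rcases le_total r n with h | h
    · exact Finset.sum_le_sum_of_subset (by simpa using h)
    · refine (Finset.sum_subset (by simpa using h) fun i _ hi => ?_).ge
      exact Nat.choose_eq_zero_of_lt (by simpa [Nat.lt_succ_iff] using hi)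
  have h0 : 0 < binBallVol n r := by
    refine lt_of_lt_of_le one_pos (le_trans ?_ (Finset.single_le_sum
      (f := fun i => n.choose i) (fun _ _ => Nat.zero_le _)
      (Finset.mem_range.2 (Nat.succ_pos r))))
    simp
  rw [Real.logb_le_iff_le_rpow (by norm_num) (by exact_mod_cast h0), Real.rpow_natCast]
  exact_mod_cast h1

theorem logb_binBallVol_nonneg (n r : ℕ) : 0 ≤ Real.logb 2 (binBallVol n r) := by
  rcases Nat.eq_zero_or_pos (binBallVol n r) with h | h
  · simp [h]
  · exact Real.logb_nonneg (by norm_num) (by exact_mod_cast h)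

/-- The Gilbert–Varshamov bound with a gain linear in the radius, under explicit conditions. -/
theorem maxPermArray_lower_bound {n r : ℕ} {α s L : ℝ} (hα : 0 ≤ α) (hs : 1 ≤ s)
    (hsq : 1 + (s ^ 2 - 1) * α ≤ Real.exp (-L) * s) (hrα : r ≤ α * n)
    (hsn : 4 * s ≤ n) (hqn : 4 * Real.exp L ≤ n) (hr : 2 ≤ r) (hrn : 2 * r ≤ n)
    (hLr : 4 ≤ L * r) (hpoly : ((n : ℝ) + 1) ^ 2 ≤ Real.exp (L * r / 2)) :
    (n.factorial : ℝ) / permBallVol n r * ((L * r / 4 - 1) / 12) ≤ maxPermArray n (r + 1) := by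
  set W : ℝ := (permBallVol n r : ℝ) with hW
  have hW1 : 1 ≤ W := by rw [hW]; exact_mod_cast one_le_permBallVol n r
  -- Sphere growth from radius 0 to radius `r` with ratio `exp L`; this keeps the fugacity below at
  -- most 1.
  have hball : Real.exp (L * r) ≤ W := by
    have h := sphere_mul_pow_le (Real.exp_pos L).le hqn hr hrn (Nat.zero_le r)
    simp only [Nat.choose_zero_right, numDerangements_zero, mul_one, Nat.cast_one, one_mul,
      Nat.sub_zero] at h
    rw [← Real.exp_nat_mul, mul_comm] at h
    exact h.trans (by rw [hW]; exact_mod_cast sphere_le_permBallVol le_rfl)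
  have hl1 : Real.exp (L * r / 4) / W ≤ 1 := by
    rw [div_le_one (by linarith)]
    exact le_trans (Real.exp_le_exp.2 (by linarith)) hball
  have hpairs := card_closePairs_le hα hs (Real.exp_pos (-L)) hsq hrα hsn
    (by rwa [← Real.exp_neg, neg_neg]) hr hrn
  rw [← Real.exp_nat_mul] at hpairs
  -- Since `6 * K + 1 = L * r / 4`, the last hypothesis holds with equality. The square of `l` uses
  -- up only `exp (L * r / 2)` of the saving `exp (-L * r)`, and the rest absorbs `(n + 1) ^ 2`.
  obtain ⟨I, hI, hcard⟩ := exists_large_indep (G := permGraph n r) (D := W)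
    (l := Real.exp (L * r / 4) / W) (K := (L * r / 4 - 1) / 6) (by positivity) hl1
    (by linarith) (fun f => by rw [hW]; exact_mod_cast permGraph_degree_le n r f)
    (fun f => by
      have h : ((∑ g ∈ (permGraph n r).neighborFinset f, ((permGraph n r).neighborFinset g ∩
          (permGraph n r).neighborFinset f).card : ℕ) : ℝ) ≤ (closePairs n r).card := by
        exact_mod_cast permGraph_codegree_le n r f
      push_cast at h
      refine (mul_le_mul_of_nonneg_left (h.trans hpairs) (by positivity)).trans ?_
      calc (Real.exp (L * r / 4) / W) ^ 2 * (((n + 1) * W) ^ 2 * Real.exp (r * -L))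
          = (n + 1) ^ 2 * (Real.exp (L * r / 4) ^ 2 * Real.exp (r * -L)) := by
            field_simp
        _ = (n + 1) ^ 2 * Real.exp (-(L * r / 2)) := by
            rw [← Real.exp_nat_mul, ← Real.exp_add]
            congr 2
            push_cast
            ring
        _ ≤ Real.exp (L * r / 2) * Real.exp (-(L * r / 2)) := by gcongr
        _ = 1 := by rw [← Real.exp_add]; simp)
    (by rw [div_mul_cancel₀ _ (by positivity)]
        exact Real.exp_le_exp.2 (by linarith))
  have hC : IsPermArray n (r + 1) I := by
    intro x hx y hy hxy
    by_contra h
    refine hI x hx y hy ⟨hxy, ?_⟩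
    rw [← hammingDist_perm]
    omega
  have hle : (I.card : ℝ) ≤ maxPermArray n (r + 1) := by exact_mod_cast hC.card_le_maxPermArray
  refine le_trans ?_ hle
  rw [Fintype.card_perm, Fintype.card_fin] at hcard
  rw [div_mul_eq_mul_div, div_le_iff₀ (by linarith)]
  linarith

theorem eventually_sq_le_exp {a : ℝ} (ha : 0 < a) (b : ℝ) :
    ∀ᶠ n : ℕ in Filter.atTop, ((n : ℝ) + 1) ^ 2 ≤ Real.exp (a * n - b) := by
  have h := (Real.tendsto_pow_mul_exp_neg_atTop_nhds_zero 2).comp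
    ((Filter.tendsto_id.const_mul_atTop ha).comp
      (Filter.tendsto_atTop_add_const_right _ 1 tendsto_natCast_atTop_atTop))
  have hev := h.eventually_le_const (by positivity : 0 < a ^ 2 * Real.exp (-a - b))
  filter_upwards [hev] with n hn
  simp only [Function.comp_apply, id_eq, mul_pow] at hn
  rw [mul_assoc, mul_le_mul_iff_right₀ (by positivity), Real.exp_neg,
    ← div_eq_mul_inv, div_le_iff₀ (Real.exp_pos _), ← Real.exp_add] at hn
  exact hn.trans_eq (congrArg Real.exp (by ring))

/-- The condition `|d - α n| < 1` says that `d` is `α n` rounded down or up to an integer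
(so `d = α n` whenever `α n` is an integer). -/
theorem theorem2 (α : ℝ) (hα0 : 0 < α) (hα1 : α < 1 / 2) :
    ∃ c : ℝ, 0 < c ∧ ∀ n d : ℕ, 1 ≤ d → |(d : ℝ) - α * (n : ℝ)| < 1 →
      c * ((n.factorial : ℝ) / (permBallVol n (d - 1) : ℝ)) *
          Real.logb 2 (binBallVol n (d - 1) : ℝ)
        ≤ (maxPermArray n d : ℝ) := by
  -- This `s` gives `(1 + (s ^ 2 - 1) * α) / s = 2 * α * (1 - α) + 1 / 2`, which is below 1 because
  -- `α ≠ 1 / 2`.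
  set s : ℝ := 1 / (2 * α) with hs
  have hsα : s * α = 1 / 2 := by rw [hs]; field_simp
  have hs1 : 1 ≤ s := by rw [hs, le_div_iff₀ (by positivity)]; linarith
  set q : ℝ := 2 * α * (1 - α) + 1 / 2 with hq
  have hq0 : 0 < q := by nlinarith
  have hq1 : q < 1 := by nlinarith [sq_nonneg (α - 1 / 2), sq_pos_of_pos (by linarith : 0 < 1 / 2 - α)]
  set L : ℝ := -Real.log q with hL
  have hL0 : 0 < L := by rw [hL]; linarith [Real.log_neg hq0 hq1]
  have hexp : Real.exp (-L) = q := by rw [hL, neg_neg, Real.exp_log hq0]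
  have hsq : 1 + (s ^ 2 - 1) * α ≤ Real.exp (-L) * s := by
    rw [hexp, hq]
    have : s ^ 2 * α = s / 2 := by rw [sq, mul_assoc, hsα]; ring
    nlinarith
  have hev : ∀ᶠ n : ℕ in Filter.atTop, 4 * s ≤ n ∧ 4 * Real.exp L ≤ n ∧ 4 ≤ α * n ∧
      16 * (1 + L) ≤ L * α * n ∧ ((n : ℝ) + 1) ^ 2 ≤ Real.exp (L * α / 2 * n - L) := by
    have hn := tendsto_natCast_atTop_atTop (R := ℝ)
    exact (hn.eventually_ge_atTop _).and <| (hn.eventually_ge_atTop _).and <|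
      ((hn.const_mul_atTop hα0).eventually_ge_atTop _).and <|
      ((hn.const_mul_atTop (mul_pos hL0 hα0)).eventually_ge_atTop _).and <|
      eventually_sq_le_exp (by positivity) L
  obtain ⟨N, hN⟩ := Filter.eventually_atTop.1 hev
  -- The first constant serves `n ≥ N`, where `(L * r / 4 - 1) / 12 ≥ L * α * n / 96`. The second
  -- brings the bound down to at most 1 for `n ≤ N`, where a single permutation suffices.
  refine ⟨min (L * α / 96) (1 / (N.factorial * (N + 1))), by positivity, fun n d hd hdn => ?_⟩
  obtain ⟨r, rfl⟩ : ∃ r, d = r + 1 := ⟨d - 1, by omega⟩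
  rw [Nat.add_sub_cancel]
  rw [abs_lt] at hdn
  push_cast at hdn
  have hlog := logb_binBallVol_le n r
  have hlog0 := logb_binBallVol_nonneg n r
  have hV : (1 : ℝ) ≤ permBallVol n r := by exact_mod_cast one_le_permBallVol n r
  rcases le_total N n with hn | hn
  · obtain ⟨h1, h2, h3, h4, h5⟩ := hN n hn
    have hrα : (r : ℝ) ≤ α * n := by linarith
    have hrlow : α * n - 2 ≤ r := by linarith
    have hLr : L * α * n - 2 * L ≤ L * r := by nlinarith
    have hr2 : 2 ≤ r := by exact_mod_cast (by linarith : (2 : ℝ) ≤ r)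
    have hrn : 2 * r ≤ n := by
      have : (2 : ℝ) * r ≤ n := by nlinarith [(Nat.cast_nonneg n : (0 : ℝ) ≤ n)]
      exact_mod_cast this
    refine le_trans ?_ (maxPermArray_lower_bound hα0.le hs1 hsq hrα h1 h2 hr2 hrn
      (by linarith) (h5.trans (Real.exp_le_exp.2 (by linarith))))
    rw [mul_comm (min _ _), mul_assoc]
    refine mul_le_mul_of_nonneg_left ?_ (by positivity)
    calc _ ≤ L * α / 96 * n := by
          refine mul_le_mul (min_le_left _ _) hlog hlog0 (by positivity)
      _ ≤ _ := by linarith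
  · calc _ ≤ 1 / ((N.factorial : ℝ) * (N + 1)) * (N.factorial : ℝ) * (N + 1) := by
          have hf : (n.factorial : ℝ) / permBallVol n r ≤ N.factorial := by
            rw [div_le_iff₀ (by linarith)]
            have : (n.factorial : ℝ) ≤ N.factorial := by exact_mod_cast Nat.factorial_le hn
            nlinarith [(Nat.cast_nonneg N.factorial : (0 : ℝ) ≤ N.factorial)]
          have hnN : (n : ℝ) ≤ N := by exact_mod_cast hn
          gcongr
          · exact min_le_right _ _
          · linarith
      _ = 1 := by field_simp
      _ ≤ _ := by exact_mod_cast one_le_maxPermArray n (r + 1)
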